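/- Let $n\ge 0$. A subgroup of $\mathrm{GL}(n+1,\mathbb{C})$ is called *triangularizable* if it is conjugate in $\mathrm{GL}(n+1,\mathbb{C})$ to a group of upper triangular matrices, and *virtually triangularizable* if it has a triangularizable subgroup of finite index. Let $\mathrm{PSL}(n+1,\mathbb{C})=\mathrm{SL}(n+1,\mathbb{C})/\{\text{scalar matrices}\}$ carry the quotient topology and act on $\mathbb{CP}^n$ as usual. A *full flag* in $\mathbb{CP}^n$ is a chain of projective subspaces $V_0\subsetneq V_1\subsetneq\dots\subsetneq V_{n-1}$ with $\dim V_k=k$ (for $n=2$: a point on a line); it is *invariant* under a group if every element of the group maps each $V_k$ onto itself. A group is *virtually solvable* if it has a solvable subgroup of finite index. 1. Every discrete solvable subgroup $G\subset\mathrm{GL}(n+1,\mathbb{C})$ is virtually triangularizable; in particular, this holds for every discrete solvable subgroup of $\mathrm{GL}(3,\mathbb{C})$. 2. Every discrete solvable subgroup $\Gamma\subset\mathrm{PSL}(n+1,\mathbb{C})$ contains a finite-index subgroup that leaves a full flag in $\mathbb{CP}^n$ invariant. 3. Every subgroup $\Gamma\subset\mathrm{PSL}(3,\mathbb{C})$ that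 leaves a full flag in $\mathbb{CP}^2$ invariant is solvable. 4. A discrete group $\Gamma\subset\mathrm{PSL}(3,\mathbb{C})$ is virtually solvable if and only if it contains a finite-index subgroup that leaves a full flag in $\mathbb{CP}^2$ invariant. -/

import Mathlib

open scoped MatrixGroups LinearAlgebra.Projectivization Pointwise

/-- `H` is a subgroup of finite index of the subgroup `K` (both inside `G`). -/
def IsFiniteIndexSubgroupOf {G : Type*} [Group G] (H K : Subgroup G) : Prop :=
  H ≤ K ∧ (H.subgroupOf K).FiniteIndex

/-- `K` has a solvable subgroup of finite index. -/
def IsVirtuallySolvable {G : Type*} [Group G] (K : Subgroup G) : Prop :=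
  ∃ H : Subgroup G, IsFiniteIndexSubgroupOf H K ∧ Group.IsSolvable H

/-- All elements of `H` become upper triangular after conjugation by one invertible matrix. -/
def IsTriangularizable {m : ℕ} (H : Subgroup (GL (Fin m) ℂ)) : Prop :=
  ∃ P : GL (Fin m) ℂ, ∀ g ∈ H, ∀ i j : Fin m, j < i →
    (P⁻¹ * g * P : GL (Fin m) ℂ).val i j = 0

/-- Some finite-index subgroup is triangularizable. -/
def IsVirtuallyTriangularizable {m : ℕ} (G : Subgroup (GL (Fin m) ℂ)) : Prop :=
  ∃ H : Subgroup (GL (Fin m) ℂ), IsFiniteIndexSubgroupOf H G ∧ IsTriangularizable H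

/-- A full flag in complex projective `n`-space: projective subspaces
`V 0 ⊂ V 1 ⊂ ⋯ ⊂ V (n - 1)`, where `V k` has projective dimension `k`, that is, its cone is a
linear subspace of dimension `k + 1`.  For `n = 2` this is a point on a line. -/
structure FullFlag (n : ℕ) where
  V : Fin n → Projectivization.Subspace ℂ (Fin (n + 1) → ℂ)
  strictMono : StrictMono V
  finrank_eq : ∀ k : Fin n,
    Module.finrank ℂ (Projectivization.Subspace.submodule (V k)) = (k : ℕ) + 1

/-- Every element of `H` maps every member of the flag onto itself; `PSL(n + 1, ℂ)` acts on
projective space as usual. -/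
def LeavesInvariant {n : ℕ} (H : Subgroup PSL(n + 1, ℂ)) (F : FullFlag n) : Prop :=
  ∀ g ∈ H, ∀ k : Fin n,
    g • (F.V k : Set (ℙ ℂ (Fin (n + 1) → ℂ))) = (F.V k : Set (ℙ ℂ (Fin (n + 1) → ℂ)))

/-- Some finite-index subgroup leaves a full flag invariant. -/
def VirtuallyLeavesFullFlagInvariant {n : ℕ} (K : Subgroup PSL(n + 1, ℂ)) : Prop :=
  ∃ H : Subgroup PSL(n + 1, ℂ), IsFiniteIndexSubgroupOf H K ∧
    ∃ F : FullFlag n, LeavesInvariant H F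

/-! This is the Lie–Kolchin–Mal'cev argument: over an algebraically closed field, a solvable linear
group virtually preserves a complete flag. Take a minimal nonzero subspace invariant under some
finite-index subgroup. There the action is strongly irreducible (irreducible on every finite-index
subgroup), and such an action of a solvable group is by scalars. This is proved up the derived
series by `exists_eq_smul_one_of_commutator`: if commutators in a normal subgroup are scalar,
determinants make those scalars roots of unity, so each element has finitely many conjugate
operators, is centralized by a finite-index subgroup, and is scalar by Schur's lemma. The resulting
common eigenvector and induction on the quotient give the flag. An adapted basis triangularizes in
`GL`; for `PSL` one lifts to `SL`, a central extension.

Conversely, a flag stabilizer is solvable because commutators act unipotently and further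
commutators lower the flag ever more steeply (`isSolvable_of_invariant_flag`). -/

open scoped commutatorElement

/-- A subgroup separated by a function with finite range has finite index. -/
theorem Subgroup.finiteIndex_of_finite_range {G S : Type*} [Group G] (H : Subgroup G) (f : G → S)
    (hf : (Set.range f).Finite) (h : ∀ a b, f a = f b → a⁻¹ * b ∈ H) : H.FiniteIndex := by
  have := hf.to_subtype
  have : Finite (G ⧸ H) := by
    refine Finite.of_injective (fun q : G ⧸ H => (⟨f q.out, q.out, rfl⟩ : Set.range f)) ?_
    intro p q hpq
    have := h _ _ (Subtype.ext_iff.mp hpq)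
    rw [← QuotientGroup.out_eq' p, ← QuotientGroup.out_eq' q]
    exact QuotientGroup.eq.mpr this
  exact Subgroup.finiteIndex_of_finite_quotient

theorem Subgroup.finiteIndex_map_subtype {G : Type*} [Group G] {H : Subgroup G} (K : Subgroup H)
    (hH : H.FiniteIndex) (hK : K.FiniteIndex) : (K.map H.subtype).FiniteIndex := by
  rw [Subgroup.finiteIndex_iff, Subgroup.index_map_subtype]
  exact mul_ne_zero hK.index_ne_zero hH.index_ne_zero

/-! ### Commuting families of endomorphisms -/

section Commuting

variable {K W : Type*} [Field K] [AddCommGroup W] [Module K W]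
  [FiniteDimensional K W]

/-- A pairwise commuting family of endomorphisms has a common eigenvector. -/
theorem Module.End.exists_common_eigenvector_of_commute [IsAlgClosed K] [Nontrivial W]
    (S : Set (Module.End K W))
    (hS : ∀ x ∈ S, ∀ y ∈ S, Commute x y) :
    ∃ w : W, w ≠ 0 ∧ ∀ x ∈ S, ∃ c : K, x w = c • w := by
  obtain ⟨U, ⟨hU0, hU⟩, hmin⟩ := WellFounded.has_min (wellFounded_lt (α := Submodule K W))
    {U | U ≠ ⊥ ∧ ∀ x ∈ S, ∀ u ∈ U, x u ∈ U} ⟨⊤, top_ne_bot, by simp⟩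
  obtain ⟨w, hwU, hw0⟩ := Submodule.exists_mem_ne_zero_of_ne_bot hU0
  refine ⟨w, hw0, fun x hx => ?_⟩
  have : Nontrivial U := Submodule.nontrivial_iff_ne_bot.mpr hU0
  obtain ⟨c, hc⟩ := Module.End.exists_eigenvalue (x.restrict (hU x hx))
  obtain ⟨v, hv⟩ := hc.exists_hasEigenvector
  refine ⟨c, ?_⟩
  -- Commutation makes this nonzero piece of `U` invariant again, so minimality puts all of `U`,
  -- hence `w`, in the eigenspace.
  have hle : ¬ (U ⊓ Module.End.eigenspace x c < U) := by
    refine hmin _ ⟨?_, ?_⟩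
    · refine Submodule.ne_bot_iff _ |>.mpr ⟨v, ⟨v.2, ?_⟩, by simpa using hv.2⟩
      have := congrArg Subtype.val hv.apply_eq_smul
      exact Module.End.mem_eigenspace_iff.mpr (by simpa using this)
    · rintro y hy u ⟨huU, hu⟩
      refine ⟨hU y hy u huU, ?_⟩
      have hu' : x u = c • u := Module.End.mem_eigenspace_iff.mp hu
      refine Module.End.mem_eigenspace_iff.mpr ?_
      rw [← Module.End.mul_apply, hS x hx y hy, Module.End.mul_apply, hu', map_smul]
  have heq : U ⊓ Module.End.eigenspace x c = U :=
    (inf_le_left.eq_or_lt).resolve_right hle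
  exact Module.End.mem_eigenspace_iff.mp (heq.ge hwU).2

/-- Only finitely many characters of a commuting family have a nonzero weight vector. -/
theorem Module.End.finite_weights_of_commute {ι : Type*} (f : ι → Module.End K W)
    (hf : ∀ i j, Commute (f i) (f j)) :
    {χ : ι → K | ∃ w : W, w ≠ 0 ∧ ∀ i, f i w = χ i • w}.Finite := by
  have hind := Module.End.independent_iInf_maxGenEigenspace_of_forall_mapsTo f
    (fun i j φ => Module.End.mapsTo_maxGenEigenspace_of_comm (hf j i) φ)
  refine (WellFoundedGT.finite_ne_bot_of_iSupIndep hind).subset ?_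
  rintro χ ⟨w, hw0, hw⟩
  refine (Submodule.ne_bot_iff _).mpr ⟨w, ?_, hw0⟩
  rw [Submodule.mem_iInf]
  intro i
  exact (f i).genEigenspace (χ i) |>.monotone (by simp : (1 : ℕ∞) ≤ ⊤)
    (Module.End.mem_eigenspace_iff.mpr (hw i))

end Commuting

/-! ### Strongly irreducible representations of solvable groups -/

namespace Representation

variable {K G W : Type*} [Field K] [Group G] [AddCommGroup W] [Module K W]

/-- Irreducibility of the restrictions to all subgroups of finite index. -/
def IsStronglyIrreducible (ρ : Representation K G W) : Prop :=
  ∀ H : Subgroup G, H.FiniteIndex → ∀ U : Submodule K W, (∀ h ∈ H, ∀ u ∈ U, ρ h u ∈ U) →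
    U = ⊥ ∨ U = ⊤

variable [IsAlgClosed K] [FiniteDimensional K W] [Nontrivial W] {ρ : Representation K G W}

/-- Schur's lemma for a finite-index subgroup: an eigenspace of `x` is nonzero and invariant under
`H`. -/
theorem IsStronglyIrreducible.exists_eq_smul_one_of_commute (hρ : ρ.IsStronglyIrreducible)
    (H : Subgroup G) (hH : H.FiniteIndex) (x : Module.End K W) (hx : ∀ h ∈ H, Commute (ρ h) x) :
    ∃ c : K, x = c • 1 := by
  obtain ⟨c, hc⟩ := Module.End.exists_eigenvalue x
  refine ⟨c, ?_⟩
  have key := hρ H hH (Module.End.eigenspace x c) (by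
    intro h hh u hu
    have hu' : x u = c • u := Module.End.mem_eigenspace_iff.mp hu
    refine Module.End.mem_eigenspace_iff.mpr ?_
    rw [← Module.End.mul_apply, ← (hx h hh).eq, Module.End.mul_apply, hu', map_smul])
  have htop := key.resolve_left hc
  ext w
  have : w ∈ Module.End.eigenspace x c := htop ▸ Submodule.mem_top
  simpa using Module.End.mem_eigenspace_iff.mp this

/-- By orbit-stabilizer, the elements whose operators commute with `ρ b` form a finite-index
subgroup, and Schur's lemma applies to it. -/
theorem IsStronglyIrreducible.exists_eq_smul_one_of_finite_conj (hρ : ρ.IsStronglyIrreducible)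
    (b : G) (hb : (Set.range fun g : G => ρ (g * b * g⁻¹)).Finite) : ∃ c : K, ρ b = c • 1 := by
  let H : Subgroup G := (Subgroup.centralizer {ρ.toHomUnits b}).comap ρ.toHomUnits
  have hmem : ∀ h, h ∈ H ↔ ρ h * ρ b = ρ b * ρ h := by
    intro h
    simp only [H, Subgroup.mem_comap, Subgroup.mem_centralizer_singleton_iff, Units.ext_iff]
    rfl
  refine hρ.exists_eq_smul_one_of_commute H ?_ (ρ b) fun h hh => (hmem h).mp hh
  refine H.finiteIndex_of_finite_range _ hb fun x y hxy => (hmem _).mpr ?_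
  have h1 : ρ (x⁻¹ * y * b * y⁻¹ * x) = ρ b := by
    have : ρ (x⁻¹ * (y * b * y⁻¹) * x) = ρ (x⁻¹ * (x * b * x⁻¹) * x) := by
      simp only [map_mul] at hxy ⊢
      rw [hxy]
    simpa [mul_assoc, ← map_mul] using this
  calc ρ (x⁻¹ * y) * ρ b = ρ (x⁻¹ * y * b * y⁻¹ * x) * ρ (x⁻¹ * y) := by
        rw [← map_mul, ← map_mul]; congr 1; group
    _ = _ := by rw [h1]

/-- A normal subgroup with commutative image acts by scalars. -/
theorem IsStronglyIrreducible.exists_eq_smul_one_of_commutative (hρ : ρ.IsStronglyIrreducible)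
    (Z : Subgroup G) [Z.Normal] (hZ : ∀ x ∈ Z, ∀ y ∈ Z, Commute (ρ x) (ρ y)) :
    ∀ z ∈ Z, ∃ c : K, ρ z = c • 1 := by
  obtain ⟨w, hw0, hw⟩ := Module.End.exists_common_eigenvector_of_commute (ρ '' (Z : Set G)) (by
    rintro _ ⟨x, hx, rfl⟩ _ ⟨y, hy, rfl⟩
    exact hZ x hx y hy)
  have hw' : ∀ z : Z, ∃ c : K, ρ z w = c • w := fun z => hw _ ⟨z, z.2, rfl⟩
  choose χ hχ using hw'
  have hfin := Module.End.finite_weights_of_commute (fun z : Z => ρ (z : G))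
    fun x y => hZ x x.2 y y.2
  let cj : G → Z → Z := fun g z => ⟨g⁻¹ * z * g, by
    simpa using Subgroup.Normal.conj_mem ‹Z.Normal› z z.2 g⁻¹⟩
  have cj_mul : ∀ g h z, cj (g * h) z = cj h (cj g z) := fun g h z => by
    ext; simp [cj, mul_assoc]
  have cj_one : ∀ z, cj 1 z = z := fun z => by ext; simp [cj]
  -- The group permutes the finitely many weights of `Z`, so the stabilizer of `χ` has finite index.
  -- It preserves the weight space of `χ`, which must then be everything.
  let H : Subgroup G :=
    { carrier := {h | ∀ z, χ (cj h z) = χ z}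
      one_mem' := fun z => by rw [cj_one]
      mul_mem' := fun {a b} ha hb z => by rw [cj_mul, hb, ha]
      inv_mem' := fun {a} ha z => by rw [← ha (cj a⁻¹ z), ← cj_mul, inv_mul_cancel, cj_one] }
  have hH : H.FiniteIndex := by
    refine H.finiteIndex_of_finite_range (fun g z => χ (cj g z)) (hfin.subset ?_) ?_
    · rintro _ ⟨g, rfl⟩
      refine ⟨ρ g w, ?_, fun z => ?_⟩
      · intro h0
        apply hw0
        have := congrArg (ρ g⁻¹) h0
        simpa using this
      · have := hχ (cj g z)
        have h2 := congrArg (ρ g) this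
        rw [map_smul, ← Module.End.mul_apply, ← map_mul] at h2
        rw [← h2, ← Module.End.mul_apply, ← map_mul]
        congr 2
        simp [cj, mul_assoc]
    · intro a b hab z
      have := congrFun hab (cj a⁻¹ z)
      simp only [← cj_mul] at this
      rw [cj_mul, ← cj_mul a⁻¹ b, ← this, inv_mul_cancel, cj_one]
  let U : Submodule K W := ⨅ z : Z, Module.End.eigenspace (ρ z) (χ z)
  have hUmem : ∀ u, u ∈ U ↔ ∀ z : Z, ρ z u = χ z • u := fun u => by
    simp [U, Submodule.mem_iInf]
  have hU : U = ⊤ := by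
    refine (hρ H hH U fun h hh u hu => ?_).resolve_left
      ((Submodule.ne_bot_iff _).mpr ⟨w, (hUmem w).mpr hχ, hw0⟩)
    rw [hUmem] at hu ⊢
    intro z
    have h2 := congrArg (ρ h) (hu (cj h z))
    rw [map_smul, ← Module.End.mul_apply, ← map_mul, hh z] at h2
    rw [← h2, ← Module.End.mul_apply, ← map_mul]
    congr 2
    simp [cj, mul_assoc]
  intro z hz
  refine ⟨χ ⟨z, hz⟩, ?_⟩
  ext v
  simpa using (hUmem v).mp (hU ▸ Submodule.mem_top) ⟨z, hz⟩

/-- A normal subgroup whose commutators act by scalars acts by scalars. -/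
theorem IsStronglyIrreducible.exists_eq_smul_one_of_commutator (hρ : ρ.IsStronglyIrreducible)
    (B : Subgroup G) [B.Normal] (hB : ∀ x ∈ B, ∀ y ∈ B, ∃ c : K, ρ ⁅x, y⁆ = c • 1) :
    ∀ b ∈ B, ∃ c : K, ρ b = c • 1 := by
  have hdet : ∀ g : G, LinearMap.det (ρ g) ≠ 0 := fun g h => by
    have : LinearMap.det (ρ g) * LinearMap.det (ρ g⁻¹) = 1 := by
      rw [← map_mul, ← map_mul, mul_inv_cancel, map_one, map_one]
    simp [h] at this
  let n := Module.finrank K W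
  have hn : 0 < n := Module.finrank_pos
  -- The elements of `B` whose operators are central in the image of `B`; the commutative case makes
  -- them scalar.
  let Z : Subgroup G :=
    { carrier := {b | b ∈ B ∧ ∀ x ∈ B, ρ b * ρ x = ρ x * ρ b}
      one_mem' := ⟨B.one_mem, by simp⟩
      mul_mem' := fun {a b} ha hb => ⟨B.mul_mem ha.1 hb.1, fun x hx => by
        rw [map_mul, mul_assoc, hb.2 x hx, ← mul_assoc, ha.2 x hx, mul_assoc]⟩
      inv_mem' := fun {a} ha => ⟨B.inv_mem ha.1, fun x hx => by
        have h1 : ρ a⁻¹ * (ρ a * ρ x) * ρ a⁻¹ = ρ a⁻¹ * (ρ x * ρ a) * ρ a⁻¹ := by rw [ha.2 x hx]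
        simp only [← map_mul] at h1 ⊢
        simpa [mul_assoc] using h1.symm⟩ }
  have hZn : Z.Normal := ⟨fun z hz g => ⟨Subgroup.Normal.conj_mem ‹_› z hz.1 g, fun x hx => by
    have h1 := hz.2 (g⁻¹ * x * g) (by simpa using Subgroup.Normal.conj_mem ‹B.Normal› x hx g⁻¹)
    have h2 : ρ g * (ρ z * ρ (g⁻¹ * x * g)) * ρ g⁻¹ = ρ g * (ρ (g⁻¹ * x * g) * ρ z) * ρ g⁻¹ := by
      rw [h1]
    simp only [← map_mul] at h2 ⊢
    simpa [mul_assoc] using h2⟩⟩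
  have hZ := hρ.exists_eq_smul_one_of_commutative Z fun x hx y hy => hx.2 y hy.1
  obtain ⟨s, hsB, hspan⟩ := Submodule.fg_span_iff_fg_span_finset_subset (ρ '' (B : Set G)) |>.mp
    (IsNoetherian.noetherian (Submodule.span K (ρ '' (B : Set G))))
  intro b hb
  refine hρ.exists_eq_smul_one_of_finite_conj b ?_
  classical
  have hroots : {c : K | c ^ n = 1}.Finite :=
    (Polynomial.nthRoots n (1 : K)).toFinset.finite_toSet.subset fun c hc => by
      simpa [Polynomial.mem_nthRoots hn] using hc
  have hscal : ∀ x y : G, ∀ c : K, LinearMap.det (ρ x) = LinearMap.det (ρ y) →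
      ρ x = c • ρ y → c ^ n = 1 := fun x y c hxy h => by
    rw [h, LinearMap.det_smul] at hxy
    exact mul_right_cancel₀ (hdet y) (hxy.trans (one_mul _).symm)
  have hcomm : ∀ x ∈ ρ '' (B : Set G), ∀ y ∈ s, ∃ c : K, c ^ n = 1 ∧ x * y = c • (y * x) := by
    rintro _ ⟨x, hx, rfl⟩ y hy
    obtain ⟨y, hyB, rfl⟩ := hsB hy
    obtain ⟨c, hc⟩ := hB x hx y hyB
    have h1 : ρ (x * y) = c • ρ (y * x) := by
      rw [show x * y = ⁅x, y⁆ * (y * x) by group, map_mul, hc, smul_mul_assoc, one_mul]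
    refine ⟨c, hscal _ _ c ?_ h1, by simpa using h1⟩
    simp [mul_comm]
  choose! κ hκ1 hκ using hcomm
  have hconjB : ∀ g, g * b * g⁻¹ ∈ B := Subgroup.Normal.conj_mem ‹_› b hb
  -- A conjugate of `b` is recorded by its commutator scalars against the finite spanning set `s`:
  -- finitely many values, all roots of unity. Two conjugates with the same record differ by an
  -- element of `Z`, hence by a scalar, again a root of unity since their determinants agree.
  refine Set.Finite.of_finite_fibers (fun x (y : s) => κ x y)
    ((Set.Finite.pi (t := fun _ : s => {c : K | c ^ n = 1}) fun _ => hroots).subset ?_) ?_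
  · rintro _ ⟨_, ⟨g, rfl⟩, rfl⟩ y -
    exact hκ1 _ ⟨_, hconjB g, rfl⟩ y y.2
  · rintro _ ⟨_, ⟨g, rfl⟩, rfl⟩
    refine (hroots.image fun c => c • ρ (g * b * g⁻¹)).subset ?_
    rintro _ ⟨⟨g', rfl⟩, hg'⟩
    have hz : (g' * b * g'⁻¹) * (g * b * g⁻¹)⁻¹ ∈ Z := by
      refine ⟨B.mul_mem (hconjB _) (B.inv_mem (hconjB _)), ?_⟩
      set p := g' * b * g'⁻¹ with hp
      set q := g * b * g⁻¹ with hq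
      have hpq : ρ q⁻¹ * ρ q = 1 := by rw [← map_mul, inv_mul_cancel, map_one]
      have hqp : ρ q * ρ q⁻¹ = 1 := by rw [← map_mul, mul_inv_cancel, map_one]
      have hs : ∀ y ∈ s, ρ (p * q⁻¹) * y = y * ρ (p * q⁻¹) := by
        intro y hy
        have e1 := hκ (ρ p) ⟨p, hconjB g', rfl⟩ y hy
        have e2 := hκ (ρ q) ⟨q, hconjB g, rfl⟩ y hy
        have e3 : κ (ρ p) y = κ (ρ q) y := congrFun hg' ⟨y, hy⟩
        have hne : κ (ρ q) y ≠ 0 := fun h0 => by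
          have := hκ1 (ρ q) ⟨q, hconjB g, rfl⟩ y hy
          rw [h0, zero_pow hn.ne'] at this
          exact zero_ne_one this
        have e4 : y * ρ q⁻¹ = κ (ρ q) y • (ρ q⁻¹ * y) := by
          calc y * ρ q⁻¹ = ρ q⁻¹ * (ρ q * y) * ρ q⁻¹ := by rw [← mul_assoc, hpq, one_mul]
            _ = κ (ρ q) y • (ρ q⁻¹ * y) := by
              rw [e2, mul_smul_comm, smul_mul_assoc, mul_assoc, mul_assoc, hqp, mul_one]
        rw [map_mul]
        apply smul_right_injective _ hne
        change κ (ρ q) y • (ρ p * ρ q⁻¹ * y) = κ (ρ q) y • (y * (ρ p * ρ q⁻¹))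
        rw [← mul_assoc, ← smul_mul_assoc (κ (ρ q) y) (y * ρ p), ← e3, ← e1, e3, mul_assoc,
          ← mul_smul_comm, ← e4, mul_assoc]
      intro x hx
      have hxs : ρ x ∈ Submodule.span K (s : Set (Module.End K W)) :=
        hspan ▸ Submodule.subset_span ⟨x, hx, rfl⟩
      generalize ρ x = v at hxs ⊢
      induction hxs using Submodule.span_induction with
      | mem y hy => exact hs y hy
      | zero => simp
      | add y z _ _ hy hz => rw [mul_add, add_mul, hy, hz]
      | smul c y _ hy => rw [mul_smul_comm, smul_mul_assoc, hy]
    obtain ⟨c, hc⟩ := hZ _ hz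
    have h1 : ρ (g' * b * g'⁻¹) = c • ρ (g * b * g⁻¹) := by
      rw [show g' * b * g'⁻¹ = ((g' * b * g'⁻¹) * (g * b * g⁻¹)⁻¹) * (g * b * g⁻¹) by group,
        map_mul, hc, smul_mul_assoc, one_mul]
    refine ⟨c, hscal _ _ c ?_ h1, h1.symm⟩
    have hd : ∀ g, LinearMap.det (ρ (g * b * g⁻¹)) = LinearMap.det (ρ b) := fun g => by
      rw [mul_assoc, map_mul, map_mul, mul_comm, ← map_mul, ← map_mul, inv_mul_cancel_right]
    rw [hd, hd]

theorem IsStronglyIrreducible.exists_eq_smul_one_of_isSolvable [Group.IsSolvable G]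
    (hρ : ρ.IsStronglyIrreducible) (g : G) : ∃ c : K, ρ g = c • 1 := by
  obtain ⟨n, hn⟩ := ‹Group.IsSolvable G›
  have key : ∀ k ≤ n, ∀ g ∈ derivedSeries G (n - k), ∃ c : K, ρ g = c • 1 := by
    intro k
    induction k with
    | zero =>
      intro _ g hg
      rw [Nat.sub_zero, hn, Subgroup.mem_bot] at hg
      exact ⟨1, by simp [hg]⟩
    | succ k ih =>
      intro hk
      have := derivedSeries_normal G (n - (k + 1))
      refine hρ.exists_eq_smul_one_of_commutator _ fun x hx y hy => ih (by omega) _ ?_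
      rw [show n - k = n - (k + 1) + 1 by omega, derivedSeries_succ]
      exact Subgroup.commutator_mem_commutator hx hy
  exact key n le_rfl g (by simp)

/-- A finite-index subgroup of a solvable linear group has a common eigenvector. -/
theorem exists_finiteIndex_common_eigenvector [Group.IsSolvable G] (ρ : Representation K G W) :
    ∃ H : Subgroup G, H.FiniteIndex ∧ ∃ w : W, w ≠ 0 ∧ ∀ h ∈ H, ∃ c : K, ρ h w = c • w := by
  obtain ⟨U, ⟨hU0, H, hH, hU⟩, hmin⟩ := WellFounded.has_min (wellFounded_lt (α := Submodule K W))
    {U | U ≠ ⊥ ∧ ∃ H : Subgroup G, H.FiniteIndex ∧ ∀ h ∈ H, ∀ u ∈ U, ρ h u ∈ U}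
    ⟨⊤, top_ne_bot, ⊤, inferInstance, by simp⟩
  have : Nontrivial U := Submodule.nontrivial_iff_ne_bot.mpr hU0
  obtain ⟨w, hwU, hw0⟩ := Submodule.exists_mem_ne_zero_of_ne_bot hU0
  let σ : Representation K H U := subrepresentation (ρ.comp H.subtype) U fun h => hU h h.2
  -- A proper nonzero subspace invariant under a finite-index subgroup of `H` would contradict the
  -- minimality of `U`.
  have hσ : σ.IsStronglyIrreducible := by
    intro H' hH' V hV
    by_contra! hne
    refine hmin (V.map U.subtype) ⟨?_, H'.map H.subtype, ?_, ?_⟩ ?_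
    · exact fun h => hne.1 (Submodule.map_injective_of_injective U.subtype_injective
        (h.trans (Submodule.map_bot _).symm))
    · exact Subgroup.finiteIndex_map_subtype H' hH hH'
    · rintro _ ⟨h, hh, rfl⟩ _ ⟨v, hv, rfl⟩
      exact ⟨_, hV h hh v hv, rfl⟩
    · refine lt_of_le_of_ne (Submodule.map_subtype_le U V) fun h => hne.2 ?_
      apply Submodule.map_injective_of_injective U.subtype_injective
      rw [h, Submodule.map_top, Submodule.range_subtype]
  refine ⟨H, hH, w, hw0, fun h hh => ?_⟩
  obtain ⟨c, hc⟩ := hσ.exists_eq_smul_one_of_isSolvable ⟨h, hh⟩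
  refine ⟨c, ?_⟩
  have := congrArg Subtype.val (LinearMap.congr_fun hc ⟨w, hwU⟩)
  exact this

end Representation

/-! ### Complete flags: existence, adapted bases, solvable stabilizers -/

section Flag

variable {K W : Type*} [Field K] [AddCommGroup W] [Module K W]

/-- A complete flag of submodules, indexed by dimension and constant from the dimension of the
space on. -/
structure IsCompleteFlag (f : ℕ → Submodule K W) : Prop where
  monotone : Monotone f
  finrank_eq : ∀ k ≤ Module.finrank K W, Module.finrank K (f k) = k

variable [FiniteDimensional K W]

theorem Submodule.finrank_comap_mkQ (L : Submodule K W) (N : Submodule K (W ⧸ L)) :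
    Module.finrank K (N.comap L.mkQ) = Module.finrank K N + Module.finrank K L := by
  have hle : L ≤ N.comap L.mkQ := fun x hx => by
    rw [Submodule.mem_comap, Submodule.mkQ_apply, (Submodule.Quotient.mk_eq_zero L).mpr hx]
    exact N.zero_mem
  have h := LinearMap.finrank_range_add_finrank_ker (L.mkQ.domRestrict (N.comap L.mkQ))
  rw [LinearMap.range_domRestrict, Submodule.map_comap_eq_of_surjective L.mkQ_surjective,
    LinearMap.ker_domRestrict, Submodule.ker_mkQ] at h
  rw [← h, ← (Submodule.submoduleOfEquivOfLe hle).finrank_eq]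
  rfl

namespace IsCompleteFlag

variable {f : ℕ → Submodule K W}

theorem zero_eq (hf : IsCompleteFlag f) : f 0 = ⊥ := Submodule.finrank_eq_zero.mp (hf.finrank_eq 0 (Nat.zero_le _))

theorem eq_top (hf : IsCompleteFlag f) {k : ℕ} (hk : Module.finrank K W ≤ k) : f k = ⊤ := by
  refine top_le_iff.mp (le_trans (Submodule.eq_top_of_finrank_eq ?_).ge (hf.monotone hk))
  exact hf.finrank_eq _ le_rfl

theorem exists_mem_succ (hf : IsCompleteFlag f) {k : ℕ} (hk : k < Module.finrank K W) :
    ∃ e ∈ f (k + 1), e ∉ f k := by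
  by_contra! h
  have := Submodule.finrank_mono (R := K) (show f (k + 1) ≤ f k from h)
  rw [hf.finrank_eq _ hk, hf.finrank_eq _ hk.le] at this
  omega

theorem succ_eq (hf : IsCompleteFlag f) {k : ℕ} (hk : k < Module.finrank K W) {e : W} (he : e ∈ f (k + 1))
    (he' : e ∉ f k) : f k ⊔ Submodule.span K {e} = f (k + 1) := by
  refine Submodule.eq_of_le_of_finrank_le (sup_le (hf.monotone k.le_succ) (by simpa using he)) ?_
  have hlt : f k < f k ⊔ Submodule.span K {e} :=
    left_lt_sup.mpr (by simpa using he')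
  have := Submodule.finrank_lt_finrank_of_lt hlt
  rw [hf.finrank_eq _ hk.le] at this
  rw [hf.finrank_eq _ hk]
  omega

/-- A basis adapted to a complete flag. -/
theorem exists_basis (hf : IsCompleteFlag f) {n : ℕ} (hn : Module.finrank K W = n) :
    ∃ b : Module.Basis (Fin n) K W, ∀ j : Fin n, f (j + 1) = Submodule.span K (b '' Set.Iic j) := by
  have hex : ∀ j : Fin n, ∃ e ∈ f (j + 1), e ∉ f j := fun j =>
    hf.exists_mem_succ (hn ▸ j.2)
  choose e he he' using hex
  have hspan : ∀ k ≤ n, f k = Submodule.span K (e '' {i : Fin n | (i : ℕ) < k}) := by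
    intro k
    induction k with
    | zero => intro _; simp [hf.zero_eq]
    | succ k ih =>
      intro hk
      have hset : {i : Fin n | (i : ℕ) < k + 1} = {i : Fin n | (i : ℕ) < k} ∪ {(⟨k, hk⟩ : Fin n)} := by
        ext i
        simp only [Set.mem_ofPred_eq, Set.mem_union, Set.mem_singleton_iff, Fin.ext_iff]
        omega
      rw [← hf.succ_eq (hn ▸ hk : k < _) (he ⟨k, hk⟩) (he' ⟨k, hk⟩), hset, Set.image_union,
        Submodule.span_union, Set.image_singleton, ← ih (by omega)]
  refine ⟨basisOfTopLeSpanOfCardEqFinrank e ?_ (by simp [hn]), fun j => ?_⟩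
  · rw [← hf.eq_top hn.le, hspan n le_rfl]
    exact Submodule.span_mono (Set.image_subset_range _ _)
  · rw [coe_basisOfTopLeSpanOfCardEqFinrank, hspan _ j.2]
    have : {i : Fin n | (i : ℕ) < j + 1} = Set.Iic j := by
      ext i
      rw [Set.mem_ofPred_eq, Set.mem_Iic, Fin.le_def, Nat.lt_succ_iff]
    rw [this]

end IsCompleteFlag

namespace Representation

variable {G : Type*} [Group G]

/-- A finite-index subgroup of a solvable linear group preserves a complete flag. -/
theorem exists_finiteIndex_invariant_flag [IsAlgClosed K] [Group.IsSolvable G]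
    (ρ : Representation K G W) : ∃ H : Subgroup G, H.FiniteIndex ∧
      ∃ f : ℕ → Submodule K W, IsCompleteFlag f ∧ ∀ h ∈ H, ∀ k, ∀ u ∈ f k, ρ h u ∈ f k := by
  induction hn : Module.finrank K W generalizing G W with
  | zero =>
    refine ⟨⊤, inferInstance, fun _ => ⊥, ⟨monotone_const, fun k hk => ?_⟩, fun h _ k u hu => ?_⟩
    · rw [finrank_bot]; omega
    · simp_all
  | succ n ih =>
    have : Nontrivial W := Module.nontrivial_of_finrank_pos (R := K) (by omega)
    obtain ⟨H, hH, w, hw0, hw⟩ := exists_finiteIndex_common_eigenvector ρ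
    let L := Submodule.span K {w}
    have hL : Module.finrank K L = 1 := finrank_span_singleton hw0
    let σ : Representation K H (W ⧸ L) := quotient (ρ.comp H.subtype) L (by
      rintro ⟨h, hh⟩
      rw [Submodule.span_singleton_le_iff_mem]
      obtain ⟨c, hc⟩ := hw h hh
      exact Submodule.mem_span_singleton.mpr ⟨c, hc.symm⟩)
    have hq : Module.finrank K (W ⧸ L) = n := by
      have := L.finrank_quotient_add_finrank
      omega
    obtain ⟨H', hH', f, hf, hinv⟩ := ih σ hq
    refine ⟨H'.map H.subtype, Subgroup.finiteIndex_map_subtype H' hH hH',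
      fun k => k.casesOn ⊥ fun k => (f k).comap L.mkQ, ⟨?_, ?_⟩, ?_⟩
    · refine monotone_nat_of_le_succ fun k => ?_
      cases k with
      | zero => exact bot_le
      | succ k => exact Submodule.comap_mono (hf.monotone k.le_succ)
    · intro k hk
      cases k with
      | zero => exact finrank_bot K W
      | succ k =>
        change Module.finrank K ((f k).comap L.mkQ) = _
        rw [Submodule.finrank_comap_mkQ, hf.finrank_eq k (by omega), hL]
    · rintro _ ⟨h, hh, rfl⟩ k u hu
      cases k with
      | zero =>
        have : u = 0 := hu
        simp [this]
      | succ k => exact hinv h hh k _ hu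

/-- A group acting faithfully and preserving a complete flag is solvable. -/
theorem isSolvable_of_invariant_flag {ρ : Representation K G W} (hρ : Function.Injective ρ)
    {f : ℕ → Submodule K W} (hf : IsCompleteFlag f) (hinv : ∀ g, ∀ k, ∀ u ∈ f k, ρ g u ∈ f k) :
    Group.IsSolvable G := by
  -- Elements `g` for which `ρ g - 1` lowers the flag by `j` steps; truncated subtraction is
  -- harmless since `f 0 = ⊥`.
  let U : ℕ → Subgroup G := fun j =>
    { carrier := {g | ∀ k, ∀ v ∈ f k, ρ g v - v ∈ f (k - j)}
      one_mem' := fun k v _ => by simp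
      mul_mem' := fun {a b} ha hb k v hv => by
        have : ρ (a * b) v - v = ρ a (ρ b v - v) + (ρ a v - v) := by simp
        rw [this]
        exact add_mem (hinv a _ _ (hb k v hv)) (ha k v hv)
      inv_mem' := fun {a} ha k v hv => by
        have : ρ a⁻¹ v - v = -(ρ a⁻¹ (ρ a v - v)) := by simp
        rw [this]
        exact neg_mem (hinv _ _ _ (ha k v hv)) }
  have hcomm : ∀ (j : ℕ) (g h : G), (∀ k, ∀ v ∈ f k,
      ρ g (ρ h v) - ρ h (ρ g v) ∈ f (k - j)) → ⁅g, h⁆ ∈ U j := by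
    intro j g h H k v hv
    have := H k _ (hinv (h * g)⁻¹ k v hv)
    simp only [← Module.End.mul_apply, ← map_mul] at this
    convert this using 2
    · congr 2; group
    · simp
  -- Successive quotients have dimension at most one, so `g` acts on each by a scalar; where the
  -- quotient is zero, `0` serves.
  have hscal : ∀ g k, ∃ c : K, ∀ v ∈ f k, ρ g v - c • v ∈ f (k - 1) := by
    intro g k
    rcases k with _ | k
    · exact ⟨0, fun v hv => by simpa using hinv g 0 v hv⟩
    rcases lt_or_ge k (Module.finrank K W) with hk | hk
    · obtain ⟨e, he, he'⟩ := hf.exists_mem_succ hk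
      have hsucc := hf.succ_eq hk he he'
      obtain ⟨w, hw, y, hy, hwy⟩ := Submodule.mem_sup.mp (hsucc ▸ hinv g _ e he)
      obtain ⟨c, rfl⟩ := Submodule.mem_span_singleton.mp hy
      refine ⟨c, fun v hv => ?_⟩
      obtain ⟨w', hw', y, hy, rfl⟩ := Submodule.mem_sup.mp (hsucc ▸ hv)
      obtain ⟨d, rfl⟩ := Submodule.mem_span_singleton.mp hy
      have : ρ g (w' + d • e) - c • (w' + d • e) = ρ g w' - c • w' + d • w := by
        rw [map_add, map_smul, ← hwy]
        module
      rw [this, Nat.add_sub_cancel]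
      exact add_mem (sub_mem (hinv g k _ hw') ((f k).smul_mem c hw')) ((f k).smul_mem d hw)
    · exact ⟨0, fun v hv => by rw [Nat.add_sub_cancel, hf.eq_top hk]; trivial⟩
  have hU1 : ∀ g h : G, ⁅g, h⁆ ∈ U 1 := by
    refine fun g h => hcomm 1 g h fun k v hv => ?_
    obtain ⟨c, hc⟩ := hscal g k
    obtain ⟨d, hd⟩ := hscal h k
    have : ρ g (ρ h v) - ρ h (ρ g v) = (ρ g (ρ h v - d • v) - c • (ρ h v - d • v)) -
        (ρ h (ρ g v - c • v) - d • (ρ g v - c • v)) := by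
      simp only [map_sub, map_smul]
      module
    rw [this]
    exact sub_mem (sub_mem (hinv _ _ _ (hd v hv)) ((f _).smul_mem _ (hd v hv)))
      (sub_mem (hinv _ _ _ (hc v hv)) ((f _).smul_mem _ (hc v hv)))
  have key : ∀ j, derivedSeries G (j + 1) ≤ U (j + 1) := by
    intro j
    induction j with
    | zero =>
      rw [derivedSeries_succ]
      exact Subgroup.commutator_le.mpr fun g _ h _ => hU1 g h
    | succ j ih =>
      rw [derivedSeries_succ]
      -- Since `gh - hg = (g - 1)(h - 1) - (h - 1)(g - 1)`, the drops add up to `2(j + 1)`, more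
      -- than the `j + 2` required.
      refine Subgroup.commutator_le.mpr fun g hg h hh => hcomm _ g h fun k v hv => ?_
      have hg' := ih hg
      have hh' := ih hh
      have : ρ g (ρ h v) - ρ h (ρ g v) = (ρ g (ρ h v - v) - (ρ h v - v)) -
          (ρ h (ρ g v - v) - (ρ g v - v)) := by
        simp only [map_sub]
        abel
      rw [this]
      exact hf.monotone (by omega : k - (j + 1) - (j + 1) ≤ k - (j + 1 + 1))
        (sub_mem (hg' _ _ (hh' k v hv)) (hh' _ _ (hg' k v hv)))
  refine ⟨Module.finrank K W + 1, eq_bot_iff.mpr fun g hg => ?_⟩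
  have hg' := key _ hg
  rw [Subgroup.mem_bot]
  apply hρ
  ext v
  have := hg' (Module.finrank K W) v (by rw [hf.eq_top le_rfl]; trivial)
  rw [Nat.sub_eq_zero_of_le (by omega), hf.zero_eq, Submodule.mem_bot, sub_eq_zero] at this
  simpa using this

end Representation

end Flag

/-! ### Finite-index subgroups and triangularization in `GL` -/

theorem IsFiniteIndexSubgroupOf.trans {G : Type*} [Group G] {H K L : Subgroup G}
    (hHK : IsFiniteIndexSubgroupOf H K) (hKL : IsFiniteIndexSubgroupOf K L) :
    IsFiniteIndexSubgroupOf H L := by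
  refine ⟨hHK.1.trans hKL.1, ⟨?_⟩⟩
  have h := Subgroup.relIndex_mul_relIndex H K L hHK.1 hKL.1
  change H.relIndex L ≠ 0
  rw [← h]
  exact mul_ne_zero hHK.2.index_ne_zero hKL.2.index_ne_zero

/-- The image of a finite-index subgroup under a homomorphism onto `K`. -/
theorem isFiniteIndexSubgroupOf_map {G G' : Type*} [Group G] [Group G'] {K : Subgroup G'}
    (φ : G →* K) (hφ : Function.Surjective φ) (H : Subgroup G) (hH : H.FiniteIndex) :
    IsFiniteIndexSubgroupOf ((H.map φ).map K.subtype) K := by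
  refine ⟨Subgroup.map_subtype_le _, ⟨fun h0 => hH.index_ne_zero ?_⟩⟩
  rw [Subgroup.subgroupOf, Subgroup.comap_map_eq_self_of_injective K.subtype_injective] at h0
  exact Nat.eq_zero_of_zero_dvd (h0 ▸ H.index_map_dvd hφ)

/-- Solvable subgroups of `GL(m, ℂ)` are virtually triangularizable. -/
theorem isVirtuallyTriangularizable_of_isSolvable {m : ℕ} (G : Subgroup (GL (Fin m) ℂ))
    [Group.IsSolvable G] : IsVirtuallyTriangularizable G := by
  let ρ : Representation ℂ G (Fin m → ℂ) :=
    ((Matrix.toLinAlgEquiv' : Matrix (Fin m) (Fin m) ℂ ≃ₐ[ℂ] _).toMulEquiv.toMonoidHom.comp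
      (Units.coeHom _)).comp G.subtype
  have hρ : ∀ g : G, LinearMap.toMatrix (Pi.basisFun ℂ (Fin m)) (Pi.basisFun ℂ (Fin m)) (ρ g) =
      (g : GL (Fin m) ℂ).val := fun g => by
    rw [LinearMap.toMatrix_eq_toMatrix']
    exact LinearMap.toMatrix'_toLin' _
  obtain ⟨H, hH, f, hf, hinv⟩ := ρ.exists_finiteIndex_invariant_flag
  obtain ⟨b, hb⟩ := hf.exists_basis (Module.finrank_fin_fun ℂ)
  refine ⟨_, isFiniteIndexSubgroupOf_map (MonoidHom.id G) Function.surjective_id H hH, ?_⟩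
  rw [Subgroup.map_id]
  -- The conjugating matrix has the vectors of the adapted basis as columns.
  refine ⟨⟨(Pi.basisFun ℂ (Fin m)).toMatrix b, b.toMatrix (Pi.basisFun ℂ (Fin m)),
    Module.Basis.toMatrix_mul_toMatrix_flip _ _, Module.Basis.toMatrix_mul_toMatrix_flip _ _⟩, ?_⟩
  rintro _ ⟨g, hg, rfl⟩ i j hij
  change (b.toMatrix (Pi.basisFun ℂ (Fin m)) * (g : GL (Fin m) ℂ).val *
    (Pi.basisFun ℂ (Fin m)).toMatrix b) i j = 0
  rw [← hρ, basis_toMatrix_mul_linearMap_toMatrix_mul_basis_toMatrix, LinearMap.toMatrix_apply]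
  have hmem := hinv g hg (j + 1) (b j) (hb j ▸ Submodule.subset_span ⟨j, Set.self_mem_Iic, rfl⟩)
  rw [hb j, b.mem_span_image] at hmem
  by_contra h
  exact absurd (hmem (Finsupp.mem_support_iff.mpr h)) (not_le.mpr hij)

/-! ### Passage between `PSL` and `SL`, projective and linear flags -/

section Projective

variable {n : ℕ}

/-- The representation of a subgroup of `SL(m, ℂ)` on `ℂ ^ m`. -/
noncomputable def specialLinearRep {m : ℕ} (G : Subgroup SL(m, ℂ)) :
    Representation ℂ G (Fin m → ℂ) :=
  ((Matrix.toLinAlgEquiv' : Matrix (Fin m) (Fin m) ℂ ≃ₐ[ℂ] _).toMulEquiv.toMonoidHom.comp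
    (Units.coeHom _ |>.comp Matrix.SpecialLinearGroup.toGL)).comp G.subtype

theorem specialLinearRep_injective {m : ℕ} (G : Subgroup SL(m, ℂ)) :
    Function.Injective (specialLinearRep G) := fun _ _ h =>
  Subtype.ext (Subtype.ext (Matrix.toLinAlgEquiv'.injective h))

/-- The preimage in `SL(m, ℂ)` of a subgroup of `PSL(m, ℂ)`. -/
def PSLPreimage {m : ℕ} (Γ : Subgroup PSL(m, ℂ)) : Subgroup SL(m, ℂ) :=
  Γ.comap (QuotientGroup.mk' _)

/-- The projection of the preimage of a subgroup of `PSL(m, ℂ)` onto that subgroup. -/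
def PSLPreimage.proj {m : ℕ} (Γ : Subgroup PSL(m, ℂ)) : PSLPreimage Γ →* Γ :=
  (QuotientGroup.mk' (Subgroup.center SL(m, ℂ))).subgroupComap Γ

theorem PSLPreimage.proj_surjective {m : ℕ} (Γ : Subgroup PSL(m, ℂ)) :
    Function.Surjective (PSLPreimage.proj Γ) :=
  MonoidHom.subgroupComap_surjective_of_surjective _ _ (QuotientGroup.mk'_surjective _)

/-- The kernel of the projection lies in the center of `SL`, so the preimage is an extension of a
solvable group by an abelian one. -/
theorem isSolvable_PSLPreimage {m : ℕ} (Γ : Subgroup PSL(m, ℂ)) [Group.IsSolvable Γ] :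
    Group.IsSolvable (PSLPreimage Γ) := by
  have : Group.IsSolvable (PSLPreimage.proj Γ).ker := Group.isSolvable_of_comm fun a b => by
    have ha : (QuotientGroup.mk' (Subgroup.center SL(m, ℂ))) a.1.1 = 1 :=
      congrArg Subtype.val a.2
    have ha' : a.1.1 ∈ Subgroup.center SL(m, ℂ) := (QuotientGroup.eq_one_iff _).mp ha
    exact Subtype.ext (Subtype.ext ((Subgroup.mem_center_iff.mp ha' b.1.1).symm))
  exact Group.isSolvable_of_ker_le_range (PSLPreimage.proj Γ).ker.subtype (PSLPreimage.proj Γ)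
    (Subgroup.range_subtype _).ge

theorem smul_projectiveSubspace_subset_iff (A : SL(n + 1, ℂ))
    (V : Projectivization.Subspace ℂ (Fin (n + 1) → ℂ)) :
    (QuotientGroup.mk A : PSL(n + 1, ℂ)) • (V : Set (ℙ ℂ (Fin (n + 1) → ℂ))) ⊆ V ↔
      ∀ u ∈ Projectivization.Subspace.submodule V,
        A.1.mulVec u ∈ Projectivization.Subspace.submodule V := by
  constructor
  · intro h u hu
    by_cases hu0 : u = 0
    · simp [hu0]
    intro hAu
    exact h (Set.smul_mem_smul_set (a := (QuotientGroup.mk A : PSL(n + 1, ℂ))) (hu hu0))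
  · rintro h _ ⟨p, hp, rfl⟩
    induction p using Projectivization.ind with
    | h v hv =>
      exact h v (fun _ => hp) ((smul_ne_zero_iff_ne A).mpr hv)

/-- Solvable subgroups of `PSL(n + 1, ℂ)` virtually preserve a full flag. -/
theorem virtuallyLeavesFullFlagInvariant_of_isSolvable (Γ : Subgroup PSL(n + 1, ℂ))
    [Group.IsSolvable Γ] : VirtuallyLeavesFullFlagInvariant Γ := by
  have := isSolvable_PSLPreimage Γ
  obtain ⟨H, hH, f, hf, hinv⟩ :=
    (specialLinearRep (PSLPreimage Γ)).exists_finiteIndex_invariant_flag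
  have hfin : ∀ k ≤ n + 1, Module.finrank ℂ (f k) = k := fun k hk =>
    hf.finrank_eq k (by rwa [Module.finrank_fin_fun])
  refine ⟨_, isFiniteIndexSubgroupOf_map _ (PSLPreimage.proj_surjective Γ) H hH,
    ⟨fun k => (f (k + 1)).projectivization, ?_, fun k => ?_⟩, ?_⟩
  · refine fun i j hij => (OrderIso.lt_iff_lt _).mpr ?_
    refine lt_of_le_of_ne (hf.monotone (Nat.succ_le_succ (Fin.le_def.mp hij.le))) fun h => ?_
    have h1 := congrArg (fun S : Submodule ℂ (Fin (n + 1) → ℂ) => Module.finrank ℂ S) h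
    simp only [hfin _ (by omega : (i : ℕ) + 1 ≤ n + 1),
      hfin _ (by omega : (j : ℕ) + 1 ≤ n + 1)] at h1
    have := Fin.lt_def.mp hij
    omega
  · rw [OrderIso.apply_symm_apply]
    exact hfin _ (by omega)
  · have hsub : ∀ g ∈ H, ∀ k : Fin n, (PSLPreimage.proj Γ g : PSL(n + 1, ℂ)) •
        ((f (k + 1)).projectivization : Set (ℙ ℂ (Fin (n + 1) → ℂ))) ⊆
          (f (k + 1)).projectivization := fun g hg k => by
      refine (smul_projectiveSubspace_subset_iff g.1 _).mpr ?_
      rw [OrderIso.apply_symm_apply]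
      exact hinv g hg _
    rintro _ ⟨_, ⟨g, hg, rfl⟩, rfl⟩ k
    -- The reverse inclusion is the forward one for `g⁻¹`.
    refine Set.Subset.antisymm (hsub g hg k) (Set.subset_smul_set_iff.mpr ?_)
    have := hsub g⁻¹ (H.inv_mem hg) k
    rwa [map_inv] at this

/-- The complete flag of linear subspaces associated with a full flag in projective space. -/
noncomputable def FullFlag.cone (F : FullFlag n) (k : ℕ) : Submodule ℂ (Fin (n + 1) → ℂ) :=
  if k = 0 then ⊥ else if h : k - 1 < n then
    Projectivization.Subspace.submodule (F.V ⟨k - 1, h⟩) else ⊤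

theorem FullFlag.isCompleteFlag_cone (F : FullFlag n) : IsCompleteFlag F.cone := by
  constructor
  · intro i j hij
    unfold FullFlag.cone
    split_ifs
    any_goals first | exact bot_le | exact le_top | omega
    exact (OrderIso.le_iff_le _).mpr (F.strictMono.monotone (Fin.mk_le_mk.mpr (by omega)))
  · intro k hk
    rw [Module.finrank_fin_fun] at hk
    unfold FullFlag.cone
    by_cases h0 : k = 0
    · rw [if_pos h0, finrank_bot, h0]
    rw [if_neg h0]
    by_cases h : k - 1 < n
    · rw [dif_pos h, F.finrank_eq, Fin.val_mk]
      omega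
    · rw [dif_neg h, finrank_top, Module.finrank_fin_fun]
      omega

/-- A subgroup of `PSL(n + 1, ℂ)` preserving a full flag is solvable. -/
theorem isSolvable_of_leavesInvariant (Γ : Subgroup PSL(n + 1, ℂ)) (F : FullFlag n)
    (hF : LeavesInvariant Γ F) : Group.IsSolvable Γ := by
  have : Group.IsSolvable (PSLPreimage Γ) := by
    refine Representation.isSolvable_of_invariant_flag (specialLinearRep_injective _)
      F.isCompleteFlag_cone fun g k u hu => ?_
    unfold FullFlag.cone at hu ⊢
    split_ifs at hu ⊢ with h0 h
    · rw [Submodule.mem_bot] at hu ⊢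
      rw [hu, map_zero]
    · exact (smul_projectiveSubspace_subset_iff g.1 _).mp (hF _ g.2 ⟨k - 1, h⟩).le u hu
    · trivial
  exact Group.isSolvable_of_surjective (PSLPreimage.proj_surjective Γ)

end Projective

theorem mainTheorem4 :
    (∀ (n : ℕ) (G : Subgroup (GL (Fin (n + 1)) ℂ)),
      DiscreteTopology G → Group.IsSolvable G → IsVirtuallyTriangularizable G) ∧
    (∀ (n : ℕ) (Γ : Subgroup PSL(n + 1, ℂ)),
      DiscreteTopology Γ → Group.IsSolvable Γ → VirtuallyLeavesFullFlagInvariant Γ) ∧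
    (∀ Γ : Subgroup PSL(3, ℂ),
      (∃ F : FullFlag 2, LeavesInvariant Γ F) → Group.IsSolvable Γ) ∧
    (∀ Γ : Subgroup PSL(3, ℂ), DiscreteTopology Γ →
      (IsVirtuallySolvable Γ ↔ VirtuallyLeavesFullFlagInvariant (n := 2) Γ)) := by
  refine ⟨fun n G _ _ => isVirtuallyTriangularizable_of_isSolvable G,
    fun n Γ _ _ => virtuallyLeavesFullFlagInvariant_of_isSolvable Γ,
    fun Γ ⟨F, hF⟩ => isSolvable_of_leavesInvariant (n := 2) Γ F hF, fun Γ _ => ⟨?_, ?_⟩⟩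
  · rintro ⟨H, hH, hs⟩
    obtain ⟨H', hH', hF⟩ := virtuallyLeavesFullFlagInvariant_of_isSolvable (n := 2) H
    exact ⟨H', hH'.trans hH, hF⟩
  · rintro ⟨H, hH, F, hF⟩
    exact ⟨H, hH, isSolvable_of_leavesInvariant (n := 2) H F hF⟩
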